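/- **Model.** A network is a finite connected simple graph $G$ on a vertex set $V$ (the processes), with maximum degree $\Delta$; each process $p$ of degree $\delta_p$ numbers its neighbours arbitrarily by local indices $1,\dots,\delta_p$. Every process $p$ holds a communication variable $C_p\in\{1,\dots,\Delta+1\}$, readable by its neighbours, and an internal variable $cur_p\in\{1,\dots,\delta_p\}$; a configuration assigns values to all these variables. Protocol COLORING is anonymous (the code of $p$ depends only on $\delta_p$ and $\Delta$) and consists, for each $p$, of the two guarded actions, where $C_{(cur_p)}$ is the communication variable of the neighbour of $p$ with local index $cur_p$: 1. if $C_p = C_{(cur_p)}$, then $C_p\leftarrow$ a uniformly random element of $\{1,\dots,\Delta+1\}$ and $cur_p\leftarrow (cur_p \bmod \delta_p)+1$; 2. if $C_p\ne C_{(cur_p)}$, then $cur_p\leftarrow (cur_p\bmod \delta_p)+1$. In a step from a configuration $\gamma_i$, a non-empty set $s_i\subseteq V$ is selected, and all processes of $s_i$ simultaneously execute their enabled action, reading the values in $\gamma_i$ and making independent random choices; this gives $\gamma_{i+1}$. A computation is an infinite sequence $(\gamma_i,s_i)_{i\ge 0}$ in which each $\gamma_{i+1}$ is a possible result of the step $(\gamma_i,s_i)$.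 It is a computation under the distributed fair scheduler if every process belongs to $s_i$ for infinitely many $i$ (the sets $s_i$ being otherwise arbitrary non-empty sets). A scheduling strategy chooses $s_i$, possibly at random, from the whole past $\gamma_0,s_0,\dots,s_{i-1},\gamma_i$ (but without knowledge of later random choices); together with $\gamma_0$ it determines a probability law on computations. The vertex coloring predicate holds in a configuration if $C_p\neq C_q$ for all adjacent $p,q$. **Theorem.** In every network: * (1-efficiency) in every step of every computation of COLORING under the distributed fair scheduler, every process reads the communication variables of at most one neighbour; * (closure) every computation of COLORING under the distributed fair scheduler that starts in a configuration satisfying the vertex coloring predicate satisfies it in all its configurations; * (convergence with probability 1) for every initial configuration and every scheduling strategy under which, almost surely, every process is selected infinitely often, the computation of COLORING almost surely contains a configuration that satisfies the vertex coloring predicate. That is, COLORING is a 1-efficient protocol that stabilizes to the vertex coloring predicate with probability 1 in any anonymous network. -/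

import Mathlib

open MeasureTheory ProbabilityTheory Filter

noncomputable section

universe u

namespace SelfStab

/-! ### Networks -/

/-- A network: a finite connected simple graph in which every vertex `p` numbers its neighbours by
local indices, `neighbor p i` being the neighbour of `p` with local index `i`
(the indices `1, …, δ.p` are represented by `Fin δ.p`). The numbering is arbitrary. -/
structure Network (V : Type u) [Fintype V] where
  graph : SimpleGraph V
  decAdj : DecidableRel graph.Adj
  connected : graph.Connected
  neighbor : ∀ p : V, Fin (graph.degree p) ≃ graph.neighborSet p

attribute [instance] Network.decAdj

/-- The degree `Δ` of the network. -/
def Network.maxDegree {V : Type u} [Fintype V] (N : Network V) : ℕ := N.graph.maxDegree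

/-! ### Local algorithms -/

/-- A piece of local code of a vertex with `d` neighbours that computes a value in `α` and may, on
its way, read the communication state (in `C`) of neighbours, designated by their local index. -/
inductive Code (C : Type) (d : ℕ) (α : Type) : Type
  | ret (a : α) : Code C d α
  | read (i : Fin d) (k : C → Code C d α) : Code C d α

/-- The value computed, when neighbour `i` has communication state `view i`. -/
def Code.eval {C : Type} {d : ℕ} {α : Type} (view : Fin d → C) : Code C d α → α
  | .ret a => a
  | .read i k => (k (view i)).eval view

/-- The local indices of the neighbours that are actually read by the evaluation. -/
def Code.reads {C : Type} {d : ℕ} {α : Type} (view : Fin d → C) : Code C d α → Finset (Fin d)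
  | .ret _ => ∅
  | .read i k => insert i ((k (view i)).reads view)

/-- A guarded action of a vertex with `d` neighbours, communication state in `C` and internal
state in `I`. The action yields the probability distribution of the new state of the vertex. -/
structure GuardedAction (C I : Type) (d : ℕ) where
  guard : C × I → Code C d Bool
  action : C × I → Code C d (PMF (C × I))

/-- Distribution of the new state of a vertex that executes its first enabled action
(earlier actions have priority); the state does not change if there is none. -/
def execute {C I : Type} {d : ℕ} (own : C × I) (view : Fin d → C) :
    List (GuardedAction C I d) → PMF (C × I)
  | [] => PMF.pure own
  | a :: as =>
    if (a.guard own).eval view = true then (a.action own).eval view else execute own view as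

/-- Local indices of the neighbours that are read by `execute`: those read in evaluating the guards
up to the first true one, and those read by the corresponding action. -/
def executeReads {C I : Type} {d : ℕ} (own : C × I) (view : Fin d → C) :
    List (GuardedAction C I d) → Finset (Fin d)
  | [] => ∅
  | a :: as =>
    (a.guard own).reads view ∪
      if (a.guard own).eval view = true then (a.action own).reads view
      else executeReads own view as

/-- A (probabilistic) finite-state protocol for anonymous networks: the code and the state space of
a vertex depend only on its degree. -/
structure Protocol where
  Comm : Type
  Internal : ℕ → Type
  fintypeComm : Fintype Comm
  fintypeInternal : ∀ d, Fintype (Internal d)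
  actions : ∀ d, List (GuardedAction Comm (Internal d) d)

attribute [instance] Protocol.fintypeComm Protocol.fintypeInternal

section Semantics

variable {V : Type u} [Fintype V] [DecidableEq V] (N : Network V) (P : Protocol)

/-! ### Configurations, steps, computations -/

/-- A configuration: the communication and internal state of every vertex. -/
abbrev Config : Type u := ∀ p : V, P.Comm × P.Internal (N.graph.degree p)

/-- The possible choices of the scheduler in one step. -/
abbrev Selection (V : Type u) : Type u := {s : Finset V // s.Nonempty}

/-- A configuration `γᵢ` together with the non-empty set `sᵢ` of vertices selected in it. -/
def Step : Type u := Config N P × Selection V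

variable {N P}

/-- The communication states that vertex `p` finds at its neighbours. -/
def view (γ : Config N P) (p : V) : Fin (N.graph.degree p) → P.Comm :=
  fun i => (γ (N.neighbor p i : V)).1

/-- Distribution of the next state of `p` if the vertices in `s` are selected in `γ`. -/
def localNext (γ : Config N P) (s : Selection V) (p : V) :
    PMF (P.Comm × P.Internal (N.graph.degree p)) :=
  if p ∈ s.1 then execute (γ p) (view γ p) (P.actions _) else PMF.pure (γ p)

/-- Set of neighbours read by `p` if the vertices in `s` are selected in `γ`. -/
def readSet (γ : Config N P) (s : Selection V) (p : V) : Finset V :=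
  if p ∈ s.1 then
    (executeReads (γ p) (view γ p) (P.actions _)).image (fun i => (N.neighbor p i : V))
  else ∅

/-- Distribution of the next configuration: all selected vertices execute simultaneously from `γ`,
with independent random choices. -/
def next (γ : Config N P) (s : Selection V) : PMF (Config N P) :=
  PMF.ofFintype (fun γ' => ∏ p, localNext γ s p (γ' p)) <| by
    classical
    have h := Finset.prod_univ_sum (fun p : V => Finset.univ)
      (fun p x => localNext γ s p x)
    rw [Fintype.piFinset_univ] at h
    rw [← h]
    refine Finset.prod_eq_one fun p _ => ?_
    rw [← tsum_fintype (L := .unconditional _)]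
    exact (localNext γ s p).tsum_coe

/-- `c` is a computation `(γ₀ s₀ γ₁), (γ₁ s₁ γ₂), …`: each configuration is a possible
successor of the previous one. -/
def IsComputation (c : ℕ → Step N P) : Prop :=
  ∀ i, (c (i + 1)).1 ∈ (next (c i).1 (c i).2).support

variable (N P) in
/-- A scheduler is a predicate on computations. -/
abbrev Scheduler : Type u := (ℕ → Step N P) → Prop

/-- The distributed fair scheduler: arbitrary non-empty sets of vertices may be selected, and each
vertex is selected infinitely often. -/
def distributedFair : Scheduler N P :=
  fun c => ∀ p : V, ∃ᶠ i in atTop, p ∈ (c i).2.1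

/-! ### Random computations -/

instance : MeasurableSpace (Step N P) := ⊤

instance : DiscreteMeasurableSpace (Step N P) := ⟨fun _ => trivial⟩

instance : Finite (Step N P) := inferInstanceAs (Finite (Config N P × Selection V))

variable (N P) in
/-- A strategy that resolves the choices of the scheduler. It sees the whole past
`(γ₀, s₀), …, (γₙ₋₁, sₙ₋₁)` and the current configuration `γₙ`, but not the outcome of
future random choices, and selects `sₙ`, possibly at random. -/
abbrev Strategy : Type u := ∀ n : ℕ, (Fin n → Step N P) → Config N P → PMF (Selection V)

/-- Distribution of `(γₙ₊₁, sₙ₊₁)` given `(γ₀, s₀), …, (γₙ, sₙ)`. -/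
def Strategy.nextStep (σ : Strategy N P) (n : ℕ) (h : Fin (n + 1) → Step N P) :
    PMF (Step N P) :=
  (next (h (Fin.last n)).1 (h (Fin.last n)).2).bind fun γ =>
    (σ (n + 1) h γ).map fun s => (γ, s)

/-- Distribution of `(γ₀, s₀)` for the initial configuration `γ₀`. -/
def Strategy.initial (σ : Strategy N P) (γ₀ : Config N P) : PMF (Step N P) :=
  (σ 0 Fin.elim0 γ₀).map fun s => (γ₀, s)

/-- `Strategy.nextStep` as a Markov kernel. -/
def Strategy.kernel (σ : Strategy N P) (n : ℕ) :
    Kernel (∀ _ : Finset.Iic n, Step N P) (Step N P) :=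
  Kernel.ofFunOfCountable fun h =>
    (σ.nextStep n fun i => h ⟨i, Finset.mem_Iic.2 (Nat.lt_succ_iff.1 i.2)⟩).toMeasure

instance (σ : Strategy N P) (n : ℕ) : IsMarkovKernel (σ.kernel n) :=
  ⟨fun _ => PMF.toMeasure.isProbabilityMeasure _⟩

/-- The probability law of the computation that starts in `γ₀` under the strategy `σ`. -/
def Strategy.law (σ : Strategy N P) (γ₀ : Config N P) : Measure (ℕ → Step N P) :=
  Kernel.trajMeasure (X := fun _ => Step N P) (σ.initial γ₀).toMeasure σ.kernel

/-! ### Efficiency, closure, convergence, stabilization -/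

/-- In every step of the possible computations, every vertex reads communication variables of at
most `k` neighbours. -/
def IsEfficient (S : Scheduler N P) (k : ℕ) : Prop :=
  ∀ c : ℕ → Step N P, IsComputation c → S c →
    ∀ i p, (readSet (c i).1 (c i).2 p).card ≤ k

/-- Every configuration of any computation that starts in `R` is in `R`. -/
def IsClosedUnder (S : Scheduler N P) (R : Config N P → Prop) : Prop :=
  ∀ c : ℕ → Step N P, IsComputation c → S c → R (c 0).1 → ∀ i, R (c i).1

/-- `R` converges to `R'` with probability 1: both are closed and, whatever the
(history-dependent) choices of the scheduler, a computation from a configuration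
in `R` almost surely contains a configuration in `R'`. -/
def ConvergesAlmostSurely (S : Scheduler N P) (R R' : Config N P → Prop) : Prop :=
  IsClosedUnder S R ∧ IsClosedUnder S R' ∧
    ∀ (σ : Strategy N P) (γ₀ : Config N P), R γ₀ → (∀ᵐ c ∂(σ.law γ₀), S c) →
      ∀ᵐ c ∂(σ.law γ₀), ∃ i, R' (c i).1

/-- Probabilistic self-stabilization to the predicate `R`. -/
def ProbStabilizes (S : Scheduler N P) (R : Config N P → Prop) : Prop :=
  ConvergesAlmostSurely S (fun _ => True) R

end Semantics

/-! ### The protocol COLORING -/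

/-- `cur ← (cur mod d) + 1` on `{1, …, d}`, here on `{0, …, d - 1}`. -/
def advance {d : ℕ} (cur : Fin d) : Fin d :=
  ⟨(cur.1 + 1) % d, Nat.mod_lt _ (Nat.zero_lt_of_lt cur.2)⟩

/-- The protocol COLORING with colours `{1, …, Δ + 1}` (here `{0, …, Δ}`): the communication
variable is the colour `C`, the internal variable the local index `cur` of a neighbour. -/
def coloring (Δ : ℕ) : Protocol where
  Comm := Fin (Δ + 1)
  Internal d := Fin d
  fintypeComm := inferInstance
  fintypeInternal _ := inferInstance
  actions _ :=
    [ { guard := fun own => .read own.2 fun c => .ret (decide (own.1 = c))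
        action := fun own => .ret
          ((PMF.uniformOfFintype (Fin (Δ + 1))).map fun c => (c, advance own.2)) },
      { guard := fun own => .read own.2 fun c => .ret (decide (own.1 ≠ c))
        action := fun own => .ret (PMF.pure (own.1, advance own.2)) } ]

/-- The vertex coloring predicate: neighbours have different colours. -/
def IsColored {V : Type u} [Fintype V] {N : Network V} {Δ : ℕ}
    (γ : Config N (coloring Δ)) : Prop :=
  ∀ p q : V, N.graph.Adj p q → (γ p).1 ≠ (γ q).1

end SelfStab

end

namespace SelfStab

universe w

/-! ### Transitions of a random computation under a strategy. -/

section Law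

variable {V : Type w} [Fintype V] [DecidableEq V] {N : Network V} {P : Protocol}

/-! Efficiency holds because both guards read only the neighbour designated by `cur`; closure,
because nobody redraws in a proper colouring. For convergence, probability enters once: by the
conditional Borel–Cantelli lemma, almost surely every transition that is possible infinitely often
is taken infinitely often (`Strategy.ae_frequently_transition`). The rest is deterministic. While a
conflict persists, fairness makes some vertex redraw (`exists_redraws`). With `Δ + 1` colours, all
vertices redrawing in that step may happen to avoid each other and their neighbours, and then the
set of conflicting vertices shrinks strictly (`exists_mem_support_next_conflicts_lt`). As there are
finitely many steps, some such transition is possible infinitely often, hence taken infinitely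
often. So the number of conflicts descends to `0`. -/

theorem mem_support_next {γ γ' : Config N P} {s : Selection V} :
    γ' ∈ (next γ s).support ↔ ∀ p, γ' p ∈ (localNext γ s p).support := by
  rw [PMF.mem_support_iff]
  change (∏ p, localNext γ s p (γ' p)) ≠ 0 ↔ _
  simp [Finset.prod_ne_zero_iff, PMF.mem_support_iff]

theorem Strategy.nextStep_map_fst (σ : Strategy N P) (n : ℕ) (h : Fin (n + 1) → Step N P) :
    (σ.nextStep n h).map (fun y : Step N P => y.1) =
      next (h (Fin.last n)).1 (h (Fin.last n)).2 := by
  unfold Strategy.nextStep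
  rw [PMF.map_bind]
  have : ∀ γ : Config N P, ((σ (n + 1) h γ).map fun s => ((γ, s) : Step N P)).map
      (fun y : Step N P => y.1) = PMF.pure γ := by
    intro γ
    exact (PMF.map_comp _ _ _).trans (PMF.map_const _ _)
  exact (congrArg _ (funext this)).trans (PMF.bind_pure _)

theorem Strategy.kernel_apply_config (σ : Strategy N P) (n : ℕ)
    (h : ∀ _ : Finset.Iic n, Step N P) (γ' : Config N P) :
    σ.kernel n h {y | y.1 = γ'} =
      next (h ⟨n, Finset.mem_Iic.2 le_rfl⟩).1 (h ⟨n, Finset.mem_Iic.2 le_rfl⟩).2 γ' := by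
  change (σ.nextStep n _).toMeasure _ = _
  have key := congrArg (fun q : PMF (Config N P) => q γ') (σ.nextStep_map_fst n
    (fun i => h ⟨i, Finset.mem_Iic.2 (Nat.lt_succ_iff.1 i.2)⟩))
  refine Eq.trans ?_ key
  let _ : MeasurableSpace (Config N P) := ⊤
  have := PMF.toMeasure_map_apply (p := σ.nextStep n
    (fun i => h ⟨i, Finset.mem_Iic.2 (Nat.lt_succ_iff.1 i.2)⟩)) (fun y : Step N P => y.1) {γ'}
    (fun _ _ => trivial) trivial
  rw [PMF.toMeasure_apply_singleton _ _ (MeasurableSpace.measurableSet_top)] at this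
  exact this.symm

instance (σ : Strategy N P) (γ₀ : Config N P) : IsProbabilityMeasure (σ.law γ₀) := by
  unfold Strategy.law
  infer_instance

/-- The history influences only the selection, which is made after the new configuration is drawn.
So given any event `S` of the past, that configuration depends on the current step alone. -/
theorem Strategy.law_transition (σ : Strategy N P) (γ₀ : Config N P) (n : ℕ)
    {S : Set (∀ _ : Finset.Iic n, Step N P)} (hS : MeasurableSet S) (x : Step N P)
    (γ' : Config N P) :
    σ.law γ₀ {c | Preorder.frestrictLe n c ∈ S ∧ c n = x ∧ (c (n + 1)).1 = γ'} =
      next x.1 x.2 γ' * σ.law γ₀ {c | Preorder.frestrictLe n c ∈ S ∧ c n = x} := by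
  have key := Kernel.map_frestrictLe_trajMeasure_compProd_eq_map_trajMeasure
    (X := fun _ => Step N P) (μ₀ := (σ.initial γ₀).toMeasure) (κ := σ.kernel) (a := n)
  set T : Set (∀ _ : Finset.Iic n, Step N P) :=
    S ∩ {h | h ⟨n, Finset.mem_Iic.2 le_rfl⟩ = x} with hT
  have hTm : MeasurableSet T :=
    hS.inter (measurableSet_eq_fun (measurable_pi_apply _) measurable_const)
  have hG : MeasurableSet {y : Step N P | y.1 = γ'} := MeasurableSet.of_discrete
  have e := congrArg (fun m => m (T ×ˢ {y : Step N P | y.1 = γ'})) key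
  rw [Measure.compProd_apply_prod hTm hG, Measure.map_apply (by fun_prop) (hTm.prod hG)] at e
  have e1 : ∫⁻ h in T, σ.kernel n h {y : Step N P | y.1 = γ'}
      ∂((σ.law γ₀).map (Preorder.frestrictLe n)) =
      ∫⁻ _ in T, next x.1 x.2 γ' ∂((σ.law γ₀).map (Preorder.frestrictLe n)) := by
    refine setLIntegral_congr_fun hTm fun h hh => ?_
    simp only [σ.kernel_apply_config]
    rw [show h ⟨n, Finset.mem_Iic.2 le_rfl⟩ = x from hh.2]
  have e2 := e.symm.trans e1
  rw [setLIntegral_const, Measure.map_apply (by fun_prop) hTm] at e2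
  refine Eq.trans (congrArg _ (Set.ext fun c => ?_)) e2
  exact and_assoc.symm

theorem Strategy.ae_isComputation (σ : Strategy N P) (γ₀ : Config N P) :
    ∀ᵐ c ∂(σ.law γ₀), IsComputation c := by
  have : ∀ (n : ℕ) (x : Step N P) (γ' : Config N P), γ' ∉ (next x.1 x.2).support →
      ∀ᵐ c ∂(σ.law γ₀), ¬ (c n = x ∧ (c (n + 1)).1 = γ') := by
    intro n x γ' h
    have := σ.law_transition γ₀ n MeasurableSet.univ x γ'
    rw [(PMF.apply_eq_zero_iff _ _).2 h, zero_mul] at this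
    rw [ae_iff]
    simpa using this
  have h2 : ∀ᵐ c ∂(σ.law γ₀), ∀ (n : ℕ) (x : Step N P) (γ' : Config N P),
      γ' ∉ (next x.1 x.2).support → ¬ (c n = x ∧ (c (n + 1)).1 = γ') := by
    rw [ae_all_iff]; intro n
    rw [ae_all_iff]; intro x
    rw [ae_all_iff]; intro γ'
    by_cases h : γ' ∈ (next x.1 x.2).support
    · simp [h]
    · filter_upwards [this n x γ' h] with c hc _ using hc
  filter_upwards [h2] with c hc n
  by_contra h
  exact hc n _ _ h ⟨rfl, rfl⟩

theorem Strategy.condExp_transition (σ : Strategy N P) (γ₀ : Config N P) (n : ℕ) (x : Step N P)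
    (γ' : Config N P) :
    condExp (Filtration.piLE (X := fun _ => Step N P) n) (σ.law γ₀)
        ({c : ℕ → Step N P | c n = x ∧ (c (n + 1)).1 = γ'}.indicator (1 : (ℕ → Step N P) → ℝ)) =ᵐ[σ.law γ₀]
      {c : ℕ → Step N P | c n = x}.indicator (fun _ => (next x.1 x.2 γ').toReal) := by
  have hmx : ∀ i, MeasurableSet {c : ℕ → Step N P | c i = x} := fun i =>
    measurableSet_eq_fun (measurable_pi_apply i) measurable_const
  have hmg : MeasurableSet {c : ℕ → Step N P | (c (n + 1)).1 = γ'} :=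
    (measurable_pi_apply (X := fun _ => Step N P) (n + 1))
      (MeasurableSet.of_discrete (s := {y : Step N P | y.1 = γ'}))
  have hm : MeasurableSet {c : ℕ → Step N P | c n = x ∧ (c (n + 1)).1 = γ'} := (hmx n).inter hmg
  refine (ae_eq_condExp_of_forall_setIntegral_eq (Filtration.piLE.le _)
    ((integrable_const (1 : ℝ)).indicator hm) (fun s _ _ => ?_) ?_ ?_).symm
  · exact ((integrable_const _).indicator (hmx n)).integrableOn
  · rw [Filtration.piLE_eq_comap_frestrictLe]
    rintro - ⟨t, mt, rfl⟩ -
    have mt' : MeasurableSet (Preorder.frestrictLe (π := fun _ => Step N P) n ⁻¹' t) :=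
      (Preorder.measurable_frestrictLe n) mt
    have key := σ.law_transition γ₀ n mt x γ'
    change _ = ∫ c in _, {c : ℕ → Step N P | c n = x ∧ (c (n + 1)).1 = γ'}.indicator
      (fun _ => (1 : ℝ)) c ∂_
    have key' := congrArg ENNReal.toReal key
    rw [ENNReal.toReal_mul] at key'
    rw [integral_indicator (hmx n), integral_indicator hm, setIntegral_const, setIntegral_const,
      measureReal_restrict_apply' mt', measureReal_restrict_apply' mt', smul_eq_mul, smul_eq_mul,
      mul_one, mul_comm, Set.inter_comm, Set.inter_comm _ (_ ⁻¹' t)]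
    exact key'.symm
  · rw [Filtration.piLE_eq_comap_frestrictLe]
    have hn : MeasurableSet[MeasurableSpace.pi.comap (Preorder.frestrictLe n)]
        {c : ℕ → Step N P | c n = x} :=
      ⟨{h | h ⟨n, Finset.mem_Iic.2 le_rfl⟩ = x},
        measurableSet_eq_fun (measurable_pi_apply _) measurable_const, rfl⟩
    exact (stronglyMeasurable_const.indicator hn).aestronglyMeasurable

/-- A transition that is possible infinitely often is almost surely taken infinitely often. -/
theorem Strategy.ae_frequently_transition (σ : Strategy N P) (γ₀ : Config N P) (x : Step N P)
    {γ' : Config N P} (h : γ' ∈ (next x.1 x.2).support) :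
    ∀ᵐ c ∂(σ.law γ₀), (∃ᶠ i in atTop, c i = x) →
      ∃ᶠ i in atTop, c i = x ∧ (c (i + 1)).1 = γ' := by
  -- The transition from time `n` to `n + 1` is known only at time `n + 1`, hence the shift and the
  -- dummy event at `0`.
  let s : ℕ → Set (ℕ → Step N P)
    | 0 => ∅
    | n + 1 => {c | c n = x ∧ (c (n + 1)).1 = γ'}
  have hs : ∀ n, MeasurableSet[Filtration.piLE (X := fun _ => Step N P) n] (s n) := by
    rintro (_ | n)
    · exact @MeasurableSet.empty _ (_)
    · rw [Filtration.piLE_eq_comap_frestrictLe]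
      refine ⟨{h | h ⟨n, Finset.mem_Iic.2 n.le_succ⟩ = x} ∩
        {h | (h ⟨n + 1, Finset.mem_Iic.2 le_rfl⟩).1 = γ'}, MeasurableSet.inter ?_ ?_, rfl⟩
      · exact measurableSet_eq_fun (measurable_pi_apply _) measurable_const
      · exact (measurable_pi_apply (X := fun _ : Finset.Iic (n + 1) => Step N P) _)
          (MeasurableSet.of_discrete (s := {y : Step N P | y.1 = γ'}))
  have hpos : 0 < (next x.1 x.2 γ').toReal :=
    ENNReal.toReal_pos ((PMF.mem_support_iff _ _).1 h) (PMF.apply_ne_top _ _)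
  filter_upwards [ae_mem_limsup_atTop_iff (σ.law γ₀) hs,
    ae_all_iff.2 fun n => σ.condExp_transition γ₀ n x γ'] with c hc hcond hx
  have hlim : c ∈ limsup (fun n => {c : ℕ → Step N P | c n = x}) atTop :=
    mem_limsup_iff_frequently_mem.2 hx
  -- The conditional probabilities are a fixed positive constant at each visit to `x` and `0`
  -- otherwise, so infinitely many visits make their sum diverge.
  rw [Set.limsup_eq_tendsto_sum_indicator_atTop hpos] at hlim
  have hfreq := mem_limsup_iff_frequently_mem.1 (hc.2 (hlim.congr fun n =>
    Finset.sum_congr rfl fun k _ => (hcond k).symm))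
  rw [frequently_atTop] at hfreq ⊢
  intro n
  obtain ⟨_ | k, hk, hmem⟩ := hfreq (n + 1)
  · exact hmem.elim
  · exact ⟨k, by omega, hmem⟩

end Law

end SelfStab
namespace SelfStab

universe v

section Coloring

variable {V : Type v} [Fintype V] {N : Network V} {Δ : ℕ}

/-- The colour of a vertex. -/
def color (γ : Config N (coloring Δ)) (p : V) : Fin (Δ + 1) := (γ p).1

/-- The local index of the neighbour that a vertex checks next. -/
def cur (γ : Config N (coloring Δ)) (p : V) : Fin (N.graph.degree p) := (γ p).2

theorem isColored_iff {γ : Config N (coloring Δ)} :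
    IsColored γ ↔ ∀ p q : V, N.graph.Adj p q → color γ p ≠ color γ q := Iff.rfl

theorem adj_neighbor (p : V) (i : Fin (N.graph.degree p)) : N.graph.Adj p (N.neighbor p i) :=
  (N.neighbor p i).2

variable [DecidableEq V]

/-- A selected vertex that has the colour of the neighbour it checks, and draws a new colour. -/
def Redraws (x : Step N (coloring Δ)) (p : V) : Prop :=
  p ∈ x.2.1 ∧ color x.1 p = color x.1 (N.neighbor p (cur x.1 p))

/-! ### One step of COLORING: efficiency and closure. -/

theorem execute_coloring {d : ℕ} (own : Fin (Δ + 1) × Fin d) (view : Fin d → Fin (Δ + 1)) :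
    execute (C := Fin (Δ + 1)) (I := Fin d) own view ((coloring Δ).actions d) =
      if own.1 = view own.2 then
        (PMF.uniformOfFintype (Fin (Δ + 1))).map fun c => (c, advance own.2)
      else PMF.pure (own.1, advance own.2) := by
  by_cases h : own.1 = view own.2
  · simp [coloring, execute, Code.eval, h]
  · simp [coloring, execute, Code.eval, h]

theorem executeReads_coloring_subset {d : ℕ} (own : Fin (Δ + 1) × Fin d)
    (view : Fin d → Fin (Δ + 1)) :
    executeReads (C := Fin (Δ + 1)) (I := Fin d) own view ((coloring Δ).actions d) ⊆ {own.2} := by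
  by_cases h : own.1 = view own.2
  · simp [coloring, executeReads, Code.reads, Code.eval, h]
  · simp [coloring, executeReads, Code.reads, Code.eval, h]

theorem isEfficient_coloring (S : Scheduler N (coloring Δ)) : IsEfficient S 1 := by
  intro c _ _ i p
  unfold readSet
  split_ifs
  · exact Finset.card_image_le.trans
      ((Finset.card_le_card (executeReads_coloring_subset _ _)).trans (by simp))
  · simp

theorem mem_support_execute_coloring {d : ℕ} {own y : Fin (Δ + 1) × Fin d}
    {view : Fin d → Fin (Δ + 1)} :
    y ∈ (execute (C := Fin (Δ + 1)) (I := Fin d) own view ((coloring Δ).actions d)).support ↔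
      y.2 = advance own.2 ∧ (own.1 ≠ view own.2 → y.1 = own.1) := by
  rw [execute_coloring]
  obtain ⟨a, b⟩ := y
  split_ifs with h <;> simp [PMF.support_map, h, eq_comm, and_comm]

theorem mem_support_localNext_coloring {x : Step N (coloring Δ)} {p : V}
    {y : Fin (Δ + 1) × Fin (N.graph.degree p)} :
    y ∈ (localNext x.1 x.2 p).support ↔
      y.2 = (if p ∈ x.2.1 then advance (cur x.1 p) else cur x.1 p) ∧
        (¬ Redraws x p → y.1 = color x.1 p) := by
  unfold localNext Redraws
  by_cases hp : p ∈ x.2.1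
  · rw [if_pos hp]
    refine (mem_support_execute_coloring (own := x.1 p) (view := view x.1 p)).trans ?_
    simp only [hp, if_true, true_and]
    rfl
  · rw [if_neg hp]
    refine (PMF.mem_support_pure_iff _ _).trans (Prod.ext_iff.trans ?_)
    simp only [hp, if_false, false_and, not_false_eq_true, true_imp_iff]
    exact and_comm

/-- The uniform draw has full support, so the colours of redrawing vertices are unconstrained. Later
arguments use only this description of a step. -/
theorem mem_support_next_coloring {x : Step N (coloring Δ)} {γ' : Config N (coloring Δ)} :
    γ' ∈ (next x.1 x.2).support ↔ ∀ p,
      cur γ' p = (if p ∈ x.2.1 then advance (cur x.1 p) else cur x.1 p) ∧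
        (¬ Redraws x p → color γ' p = color x.1 p) := by
  rw [mem_support_next]
  exact forall_congr' fun p => mem_support_localNext_coloring

theorem IsColored.not_redraws {x : Step N (coloring Δ)} (h : IsColored x.1) (p : V) :
    ¬ Redraws x p := fun hr => isColored_iff.1 h _ _ (adj_neighbor p _) hr.2

theorem isClosedUnder_isColored (S : Scheduler N (coloring Δ)) : IsClosedUnder S IsColored := by
  intro c hc _ h0 i
  induction i with
  | zero => exact h0
  | succ i ih =>
    have h := mem_support_next_coloring.1 (hc i)
    rw [isColored_iff] at ih ⊢
    intro p q hpq
    rw [(h p).2 (IsColored.not_redraws ih p), (h q).2 (IsColored.not_redraws ih q)]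
    exact ih p q hpq

/-! ### Fairness exposes conflicts. -/

theorem iterate_advance_val {d : ℕ} (a : Fin d) (t : ℕ) :
    (advance^[t] a : Fin d).1 = (a.1 + t) % d := by
  induction t with
  | zero => simp [Nat.mod_eq_of_lt a.2]
  | succ t ih => simp [Function.iterate_succ_apply', advance, ih, add_assoc]

theorem exists_iterate_advance_eq {d : ℕ} (a b : Fin d) : ∃ t, advance^[t] a = b := by
  -- Adding `d` keeps the natural subtraction from truncating.
  refine ⟨b.1 + d - a.1, Fin.ext ?_⟩
  have ha := a.2
  rw [iterate_advance_val, show a.1 + (b.1 + d - a.1) = b.1 + d by omega]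
  simp [Nat.mod_eq_of_lt b.2]

/-- A vertex selected again and again checks all its neighbours. -/
theorem exists_selected_cur_eq {c : ℕ → Step N (coloring Δ)} (hc : IsComputation c)
    (hf : distributedFair c) (i : ℕ) (p : V) (m : Fin (N.graph.degree p)) :
    ∃ j ≥ i, p ∈ (c j).2.1 ∧ cur (c j).1 p = m := by
  have step : ∀ j, cur (c (j + 1)).1 p =
      if p ∈ (c j).2.1 then advance (cur (c j).1 p) else cur (c j).1 p :=
    fun j => (mem_support_next_coloring.1 (hc j) p).1
  have wait : ∀ i, ∃ j ≥ i, p ∈ (c j).2.1 ∧ cur (c j).1 p = cur (c i).1 p := by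
    intro i
    have hex : ∃ k, p ∈ (c (i + k)).2.1 := by
      obtain ⟨j, hj, hp⟩ := frequently_atTop.1 (hf p) i
      exact ⟨j - i, by rwa [Nat.add_sub_cancel' hj]⟩
    refine ⟨i + Nat.find hex, by omega, Nat.find_spec hex, ?_⟩
    have : ∀ k ≤ Nat.find hex, cur (c (i + k)).1 p = cur (c i).1 p := by
      intro k
      induction k with
      | zero => simp
      | succ k ih =>
        intro hk
        rw [← ih (by omega), ← add_assoc, step, if_neg (Nat.find_min hex (by omega))]
    exact this _ le_rfl
  have reach : ∀ t, ∃ j ≥ i, p ∈ (c j).2.1 ∧ cur (c j).1 p = advance^[t] (cur (c i).1 p) := by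
    intro t
    induction t with
    | zero => exact wait i
    | succ t ih =>
      obtain ⟨j, hj, hp, hj'⟩ := ih
      obtain ⟨k, hk, hkp, hk'⟩ := wait (j + 1)
      refine ⟨k, by omega, hkp, ?_⟩
      rw [hk', step, if_pos hp, hj', Function.iterate_succ_apply']
  obtain ⟨t, ht⟩ := exists_iterate_advance_eq (cur (c i).1 p) m
  exact ht ▸ reach t

theorem color_eq_of_forall_not_redraws {c : ℕ → Step N (coloring Δ)} (hc : IsComputation c)
    {i j : ℕ} (hij : i ≤ j) (h : ∀ k, i ≤ k → k < j → ∀ p, ¬ Redraws (c k) p) :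
    color (c j).1 = color (c i).1 := by
  induction j, hij using Nat.le_induction with
  | base => rfl
  | succ j hij ih =>
    rw [← ih fun k hk hkj => h k hk (by omega)]
    funext p
    exact (mem_support_next_coloring.1 (hc j) p).2 (h j hij (by omega) p)

/-- Fairness forces a conflict to be noticed, while the colours are still unchanged. -/
theorem exists_redraws {c : ℕ → Step N (coloring Δ)} (hc : IsComputation c)
    (hf : distributedFair c) {i : ℕ} (hi : ¬ IsColored (c i).1) :
    ∃ j ≥ i, color (c j).1 = color (c i).1 ∧ ∃ p, Redraws (c j) p := by
  have hex : ∃ k, ∃ p, Redraws (c (i + k)) p := by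
    by_contra! hno
    rw [isColored_iff] at hi
    push Not at hi
    obtain ⟨p, q, hpq, hcol⟩ := hi
    -- Without redraws the colours are frozen, so when `p` eventually checks `q` the conflict is
    -- still there and `p` redraws.
    obtain ⟨j, hj, hp, hcur⟩ :=
      exists_selected_cur_eq hc hf i p ((N.neighbor p).symm ⟨q, hpq⟩)
    have hconst := color_eq_of_forall_not_redraws hc hj fun k hk _ p => by
      simpa [Nat.add_sub_cancel' hk] using hno (k - i) p
    refine hno (j - i) p ?_
    rw [Nat.add_sub_cancel' hj]
    refine ⟨hp, ?_⟩
    rw [hcur, hconst]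
    simpa using hcol
  classical
  refine ⟨i + Nat.find hex, by omega, ?_, Nat.find_spec hex⟩
  refine color_eq_of_forall_not_redraws hc (by omega) fun k hk hkj p hp => ?_
  exact Nat.find_min hex (m := k - i) (by omega) ⟨p, by rwa [Nat.add_sub_cancel' hk]⟩

/-! ### Reducing conflicts and convergence. -/

/-- Greedy recolouring: the at most `Δ` neighbours of a vertex leave one of the `Δ + 1` colours
free, and using it creates no conflict at vertices already treated. -/
theorem exists_recoloring (G : SimpleGraph V) [DecidableRel G.Adj] (hΔ : G.maxDegree ≤ Δ)
    (f : V → Fin (Δ + 1)) (T : Finset V) :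
    ∃ g : V → Fin (Δ + 1), (∀ p ∉ T, g p = f p) ∧ ∀ p ∈ T, ∀ q, G.Adj p q → g p ≠ g q := by
  induction T using Finset.induction_on with
  | empty => exact ⟨f, by simp, by simp⟩
  | insert a T ha ih =>
    obtain ⟨g, hg, hg'⟩ := ih
    obtain ⟨b, hb⟩ : ∃ b, b ∉ (G.neighborFinset a).image g := by
      by_contra! h
      have h1 : Fintype.card (Fin (Δ + 1)) ≤ ((G.neighborFinset a).image g).card :=
        Finset.card_le_card fun b _ => h b
      have h2 := Finset.card_image_le (s := G.neighborFinset a) (f := g)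
      have h3 := G.degree_le_maxDegree a
      rw [Fintype.card_fin] at h1
      rw [G.card_neighborFinset_eq_degree] at h2
      omega
    have hb' : ∀ q, G.Adj a q → b ≠ g q := by
      rintro q hq rfl
      exact hb (Finset.mem_image_of_mem g (by simpa using hq))
    refine ⟨Function.update g a b, fun p hp => ?_, fun p hp q hpq => ?_⟩
    · rw [Finset.mem_insert, not_or] at hp
      rw [Function.update_of_ne hp.1, hg p hp.2]
    · by_cases hpa : p = a
      · subst hpa
        rw [Function.update_self, Function.update_of_ne hpq.ne']
        exact hb' q hpq
      · by_cases hqa : q = a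
        · subst hqa
          rw [Function.update_self, Function.update_of_ne hpa]
          exact (hb' p hpq.symm).symm
        · rw [Function.update_of_ne hpa, Function.update_of_ne hqa]
          exact hg' p ((Finset.mem_insert.1 hp).resolve_left hpa) q hpq

/-- The vertices that share their colour with a neighbour. -/
def conflicts (G : SimpleGraph V) (f : V → Fin (Δ + 1)) : Set V := {p | ∃ q, G.Adj p q ∧ f p = f q}

theorem isColored_of_conflicts_eq_empty {γ : Config N (coloring Δ)}
    (h : conflicts N.graph (color γ) = ∅) : IsColored γ :=
  isColored_iff.2 fun p q hpq hcol =>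
    Set.eq_empty_iff_forall_notMem.1 h p ⟨q, hpq, hcol⟩

/-- If some vertex redraws its colour, a possible outcome has fewer conflicts. -/
theorem exists_mem_support_next_conflicts_lt (hΔ : N.maxDegree ≤ Δ) {x : Step N (coloring Δ)}
    {a : V} (ha : Redraws x a) :
    ∃ γ' ∈ (next x.1 x.2).support, (conflicts N.graph (color γ')).ncard <
      (conflicts N.graph (color x.1)).ncard := by
  classical
  obtain ⟨g, hg, hg'⟩ := exists_recoloring N.graph hΔ (color x.1) {p | Redraws x p}
  simp only [Finset.mem_filter, Finset.mem_univ, true_and] at hg hg'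
  refine ⟨fun p => (g p, if p ∈ x.2.1 then advance (cur x.1 p) else cur x.1 p),
    mem_support_next_coloring.2 fun p => ⟨rfl, hg p⟩, ?_⟩
  refine Set.ncard_lt_ncard ⟨?_, fun h => ?_⟩ (Set.toFinite _)
  -- Redrawn vertices are conflict-free, so both ends of a remaining conflict kept their colours;
  -- strictness comes from `a`, which leaves the set.
  · rintro p ⟨q, hpq, hcol⟩
    change g p = g q at hcol
    have hp : ¬ Redraws x p := fun hp => hg' p hp q hpq hcol
    have hq : ¬ Redraws x q := fun hq => hg' q hq p hpq.symm hcol.symm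
    exact ⟨q, hpq, by rw [← hg p hp, ← hg q hq, hcol]⟩
  · obtain ⟨q, hq, hcol⟩ := h (a := a) ⟨_, adj_neighbor a _, ha.2⟩
    exact hg' a ha q hq hcol

theorem exists_isColored_of_frequently_transition (hΔ : N.maxDegree ≤ Δ)
    {c : ℕ → Step N (coloring Δ)} (hc : IsComputation c) (hf : distributedFair c)
    (ht : ∀ (x : Step N (coloring Δ)) (γ' : Config N (coloring Δ)), γ' ∈ (next x.1 x.2).support →
      (∃ᶠ i in atTop, c i = x) → ∃ᶠ i in atTop, c i = x ∧ (c (i + 1)).1 = γ') :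
    ∃ i, IsColored (c i).1 := by
  by_contra! hno
  have descend : ∀ k : ℕ,
      ¬ ∃ᶠ i in atTop, (conflicts N.graph (color (c i).1)).ncard ≤ k := by
    intro k
    induction k with
    | zero =>
      intro h
      obtain ⟨i, hi⟩ := h.exists
      exact hno i (isColored_of_conflicts_eq_empty
        ((Set.ncard_eq_zero (Set.toFinite _)).1 (Nat.le_zero.1 hi)))
    | succ k ih =>
      intro h
      have h1 : ∃ᶠ i in atTop, ∃ x, c i = x ∧
          (conflicts N.graph (color x.1)).ncard ≤ k + 1 ∧ ∃ p, Redraws x p := by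
        rw [frequently_atTop] at h ⊢
        intro n
        obtain ⟨i, hi, hk⟩ := h n
        obtain ⟨j, hj, hcol, hp⟩ := exists_redraws hc hf (hno i)
        exact ⟨j, hi.trans hj, _, rfl, by rwa [hcol], hp⟩
      -- Pigeonhole over the finitely many steps.
      obtain ⟨x, hx⟩ : ∃ x, ∃ᶠ i in atTop, c i = x ∧
          (conflicts N.graph (color x.1)).ncard ≤ k + 1 ∧ ∃ p, Redraws x p := by
        by_contra! hall
        refine h1 ?_
        filter_upwards [eventually_all.2 fun x => hall x] with i hi
        rintro ⟨x, hx, hk, p, hp⟩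
        exact hi x hx hk p hp
      obtain ⟨_, -, hk, p, hp⟩ := hx.exists
      obtain ⟨γ', hγ', hlt⟩ := exists_mem_support_next_conflicts_lt hΔ hp
      have h2 := ht x γ' hγ' (hx.mono fun i hi => hi.1)
      refine ih ((tendsto_add_atTop_nat 1).frequently (h2.mono fun i hi => ?_))
      rw [hi.2]
      omega
  exact descend (Nat.card V) (Frequently.of_forall fun i => Set.ncard_le_card _)

theorem probStabilizes_coloring (hΔ : N.maxDegree ≤ Δ) :
    ProbStabilizes (N := N) (P := coloring Δ) distributedFair IsColored := by
  refine ⟨fun _ _ _ _ _ => trivial, isClosedUnder_isColored _, fun σ γ₀ _ hf => ?_⟩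
  have ht : ∀ᵐ c ∂(σ.law γ₀), ∀ (x : Step N (coloring Δ)) (γ' : Config N (coloring Δ)),
      γ' ∈ (next x.1 x.2).support → (∃ᶠ i in atTop, c i = x) →
        ∃ᶠ i in atTop, c i = x ∧ (c (i + 1)).1 = γ' := by
    rw [ae_all_iff]; intro x
    rw [ae_all_iff]; intro γ'
    rw [eventually_imp_distrib_left]
    exact σ.ae_frequently_transition γ₀ x
  filter_upwards [hf, σ.ae_isComputation γ₀, ht] with c h1 h2 h3
  exact exists_isColored_of_frequently_transition hΔ h2 h1 h3

end Coloring

end SelfStab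

theorem mainTheorem3 {V : Type*} [Fintype V] [DecidableEq V] (N : SelfStab.Network V) :
    SelfStab.IsEfficient (N := N) (P := SelfStab.coloring N.maxDegree)
        SelfStab.distributedFair 1 ∧
      SelfStab.ProbStabilizes (N := N) (P := SelfStab.coloring N.maxDegree)
        SelfStab.distributedFair SelfStab.IsColored :=
  ⟨SelfStab.isEfficient_coloring _, SelfStab.probStabilizes_coloring le_rfl⟩
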